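/- Let $0<p,q<1$ be fixed. Let $(m_i)_{i\in I}$ and $(n_i)_{i\in I}$ be families of nonnegative integers, indexed by a set $I$ with a filter $\ell$ (for example, sequences, with $i\to\infty$), such that $m_i\to\infty$ along $\ell$, or $n_i\to\infty$ along $\ell$, or both; when only one of them tends to infinity, nothing is assumed about the other. For each $i$, let $T_{1,i}\sim\mathrm{Binomial}(m_i,p)$ and $T_{2,i}\sim\mathrm{Binomial}(n_i,q)$ be independent random variables on a common probability space, which may depend on $i$. Then, along $\ell$, $$\frac{(T_{1,i}+T_{2,i})-(m_ip+n_iq)}{\sqrt{m_ip(1-p)+n_iq(1-q)}}\ \xrightarrow{\ d\ }\ N(0,1).$$ -/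

import Mathlib

open MeasureTheory ProbabilityTheory Filter Topology
open scoped ProbabilityTheory unitInterval

/-! Put `u = t / s`, with `s` the standard deviation of the sum, and let `vp`, `vq` be the Bernoulli
variances. The standardized sum has characteristic function `φ_p(u) ^ m * φ_q(u) ^ n`. Since `s ^ 2
= m * vp + n * vq`, the Gaussian one factors exactly as `exp(-vp u²/2) ^ m * exp(-vq u²/2) ^ n`. All
bases lie in the unit disc, so telescoping bounds the difference by `(m + n) * o(u²)`, and `(m + n)
* u² ≤ t² / min vp vq`. Hence only `m + n → ∞` matters, and Lévy's continuity theorem concludes. -/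

/-- The characteristic function of the centered Bernoulli distribution with parameter `p`. -/
noncomputable def centeredBernoulliCharFun (p : unitInterval) (u : ℝ) : ℂ :=
  (p : ℂ) * Complex.exp (((1 - p : ℝ) * Complex.I) * u) +
    (1 - (p : ℂ)) * Complex.exp ((-(p : ℝ) * Complex.I) * u)

theorem charFun_map_cast_binomial (n : ℕ) (p : unitInterval) (u : ℝ) :
    charFun (Bin(ℝ, n, p)) u = (p * Complex.exp (u * Complex.I) + (1 - (p : ℂ))) ^ n := by
  rw [charFun_apply_real, integral_map_cast_binomial, add_pow, ← Nat.range_succ_eq_Iic]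
  refine Finset.sum_congr rfl fun k _ ↦ ?_
  rw [mul_pow, ← Complex.exp_nat_mul, Complex.real_smul]
  push_cast
  rw [show (u : ℂ) * k * Complex.I = k * (u * Complex.I) by ring]
  ring

theorem charFun_map_cast_binomial_mul_exp (n : ℕ) (p : unitInterval) (u : ℝ) :
    charFun (Bin(ℝ, n, p)) u * Complex.exp (-(n * p * u) * Complex.I) =
      centeredBernoulliCharFun p u ^ n := by
  rw [charFun_map_cast_binomial, centeredBernoulliCharFun,
    show -(n * p * u : ℂ) * Complex.I = n * (-(p * u) * Complex.I) by ring,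
    Complex.exp_nat_mul, ← mul_pow, add_mul, mul_assoc, ← Complex.exp_add]
  congr 3
  · congr 2
    push_cast
    ring
  · congr 1
    ring

/-- Centering multiplies the characteristic function of `Bin(ℝ, 1, p)` by a factor of modulus one.
-/
theorem norm_centeredBernoulliCharFun_le_one (p : unitInterval) (u : ℝ) :
    ‖centeredBernoulliCharFun p u‖ ≤ 1 := by
  have h := charFun_map_cast_binomial_mul_exp 1 p u
  rw [pow_one] at h
  rw [← h, norm_mul,
    show (-(((1 : ℕ) : ℂ) * p * u) * Complex.I) = ((-(p * u) : ℝ) : ℂ) * Complex.I by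
      push_cast; ring, Complex.norm_exp_ofReal_mul_I, mul_one]
  exact norm_charFun_le_one _

theorem exp_mul_ofReal_sub_taylor_isLittleO (a : ℂ) :
    (fun u : ℝ ↦ Complex.exp (a * u) - (1 + a * u + (a * u) ^ 2 / 2)) =o[𝓝 0]
      fun u : ℝ ↦ u ^ 2 := by
  have h : Tendsto (fun u : ℝ ↦ a * (u : ℂ)) (𝓝 0) (𝓝 0) := by
    have : Continuous fun u : ℝ ↦ a * (u : ℂ) := by fun_prop
    simpa using this.tendsto 0
  have h2 := (Complex.exp_sub_sum_range_succ_isLittleO_pow 2).comp_tendsto h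
  have h3 : (fun u : ℝ ↦ (a * (u : ℂ)) ^ 2) =O[𝓝 0] fun u : ℝ ↦ u ^ 2 := by
    refine Asymptotics.IsBigO.of_bound (‖a‖ ^ 2) (.of_forall fun u ↦ ?_)
    simp [mul_pow]
  refine (h2.trans_isBigO h3).congr_left fun u ↦ ?_
  simp [Finset.sum_range_succ, Nat.factorial]

theorem exp_neg_mul_sq_sub_taylor_isLittleO (v : ℂ) :
    (fun u : ℝ ↦ Complex.exp (-(v * u ^ 2 / 2)) - (1 - v * u ^ 2 / 2)) =o[𝓝 0]
      fun u : ℝ ↦ u ^ 2 := by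
  have h : Tendsto (fun u : ℝ ↦ -(v * (u : ℂ) ^ 2 / 2)) (𝓝 0) (𝓝 0) := by
    have : Continuous fun u : ℝ ↦ -(v * (u : ℂ) ^ 2 / 2) := by fun_prop
    simpa using this.tendsto 0
  have h2 := (Complex.exp_sub_sum_range_succ_isLittleO_pow 1).comp_tendsto h
  have h3 : (fun u : ℝ ↦ (-(v * (u : ℂ) ^ 2 / 2)) ^ 1) =O[𝓝 0] fun u : ℝ ↦ u ^ 2 := by
    refine Asymptotics.IsBigO.of_bound (‖v‖ / 2) (.of_forall fun u ↦ le_of_eq ?_)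
    simp
    ring
  refine (h2.trans_isBigO h3).congr_left fun u ↦ ?_
  simp [Finset.sum_range_succ, sub_eq_add_neg]

/-- The Taylor expansions agree to second order: the mean is zero, and `p(1-p)² + (1-p)p² = p(1-p)`.
-/
theorem centeredBernoulliCharFun_sub_exp_isLittleO (p : unitInterval) :
    (fun u : ℝ ↦ centeredBernoulliCharFun p u -
      Complex.exp (-((p * (1 - p) : ℝ) * u ^ 2 / 2))) =o[𝓝 0] fun u : ℝ ↦ u ^ 2 := by
  have h1 := (exp_mul_ofReal_sub_taylor_isLittleO ((1 - p : ℝ) * Complex.I)).const_mul_left (p : ℂ)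
  have h2 := (exp_mul_ofReal_sub_taylor_isLittleO (-(p : ℝ) * Complex.I)).const_mul_left
    (1 - (p : ℂ))
  have h3 := exp_neg_mul_sq_sub_taylor_isLittleO (p * (1 - p) : ℝ)
  refine ((h1.add h2).sub h3).congr_left fun u ↦ ?_
  rw [centeredBernoulliCharFun]
  push_cast
  linear_combination (-(p : ℂ) * (1 - p) * u ^ 2 / 2) * Complex.I_sq

theorem norm_pow_sub_pow_le_of_norm_le_one {z w : ℂ} (hz : ‖z‖ ≤ 1) (hw : ‖w‖ ≤ 1) (n : ℕ) :
    ‖z ^ n - w ^ n‖ ≤ n * ‖z - w‖ := by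
  induction n with
  | zero => simp
  | succ n ih =>
    calc ‖z ^ (n + 1) - w ^ (n + 1)‖ = ‖z ^ n * (z - w) + (z ^ n - w ^ n) * w‖ := by ring_nf
      _ ≤ ‖z‖ ^ n * ‖z - w‖ + ‖z ^ n - w ^ n‖ * ‖w‖ := by
        simpa using norm_add_le (z ^ n * (z - w)) ((z ^ n - w ^ n) * w)
      _ ≤ 1 * ‖z - w‖ + (n * ‖z - w‖) * 1 := by
        gcongr
        exact pow_le_one₀ (norm_nonneg _) hz
      _ = (n + 1 : ℕ) * ‖z - w‖ := by push_cast; ring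

theorem norm_pow_mul_pow_sub_pow_mul_pow_le {z w z' w' : ℂ} (hz : ‖z‖ ≤ 1) (hw : ‖w‖ ≤ 1)
    (hz' : ‖z'‖ ≤ 1) (hw' : ‖w'‖ ≤ 1) (m n : ℕ) :
    ‖z ^ m * w ^ n - z' ^ m * w' ^ n‖ ≤ m * ‖z - z'‖ + n * ‖w - w'‖ :=
  calc ‖z ^ m * w ^ n - z' ^ m * w' ^ n‖
      = ‖(z ^ m - z' ^ m) * w ^ n + z' ^ m * (w ^ n - w' ^ n)‖ := by ring_nf
    _ ≤ ‖z ^ m - z' ^ m‖ * ‖w‖ ^ n + ‖z'‖ ^ m * ‖w ^ n - w' ^ n‖ := by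
      simpa using norm_add_le ((z ^ m - z' ^ m) * w ^ n) (z' ^ m * (w ^ n - w' ^ n))
    _ ≤ (m * ‖z - z'‖) * 1 + 1 * (n * ‖w - w'‖) := by
      gcongr
      · exact norm_pow_sub_pow_le_of_norm_le_one hz hz' m
      · exact pow_le_one₀ (norm_nonneg _) hw
      · exact pow_le_one₀ (norm_nonneg _) hz'
      · exact norm_pow_sub_pow_le_of_norm_le_one hw hw' n
    _ = m * ‖z - z'‖ + n * ‖w - w'‖ := by ring

theorem norm_exp_neg_mul_sq_le_one {v : ℝ} (hv : 0 ≤ v) (u : ℝ) :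
    ‖Complex.exp (-(v * u ^ 2 / 2))‖ ≤ 1 := by
  have h : (-(v * u ^ 2 / 2) : ℂ) = ((-(v * u ^ 2 / 2) : ℝ) : ℂ) := by push_cast; ring
  rw [h, Complex.norm_exp_ofReal, Real.exp_le_one_iff]
  have : 0 ≤ v * u ^ 2 := by positivity
  linarith

/-- The standard deviation of the sum of independent `Bin(k.1, p)` and `Bin(k.2, q)` variables. -/
noncomputable def binomialSumStdDev (p q : unitInterval) (k : ℕ × ℕ) : ℝ :=
  √((k.1 : ℝ) * (p : ℝ) * (1 - (p : ℝ)) + (k.2 : ℝ) * (q : ℝ) * (1 - (q : ℝ)))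

/-- The law of the standardized sum of independent `Bin(k.1, p)` and `Bin(k.2, q)` variables. -/
noncomputable def standardizedBinomialSum (p q : unitInterval) (k : ℕ × ℕ) : Measure ℝ :=
  ((Bin(ℝ, k.1, p) ∗ Bin(ℝ, k.2, q)).map
    (· + -((k.1 : ℝ) * (p : ℝ) + (k.2 : ℝ) * (q : ℝ)))).map ((binomialSumStdDev p q k)⁻¹ * ·)

instance (p q : unitInterval) (k : ℕ × ℕ) :
    IsProbabilityMeasure (standardizedBinomialSum p q k) := by
  have : IsProbabilityMeasure ((Bin(ℝ, k.1, p) ∗ Bin(ℝ, k.2, q)).map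
    (· + -((k.1 : ℝ) * (p : ℝ) + (k.2 : ℝ) * (q : ℝ)))) :=
    Measure.isProbabilityMeasure_map (by fun_prop)
  exact Measure.isProbabilityMeasure_map (by fun_prop)

theorem charFun_standardizedBinomialSum (p q : unitInterval) (k : ℕ × ℕ) (t : ℝ) :
    charFun (standardizedBinomialSum p q k) t =
      centeredBernoulliCharFun p ((binomialSumStdDev p q k)⁻¹ * t) ^ k.1 *
        centeredBernoulliCharFun q ((binomialSumStdDev p q k)⁻¹ * t) ^ k.2 := by
  rw [standardizedBinomialSum, charFun_map_mul, charFun_map_add_const, charFun_conv,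
    ← charFun_map_cast_binomial_mul_exp, ← charFun_map_cast_binomial_mul_exp]
  set u := (binomialSumStdDev p q k)⁻¹ * t
  rw [mul_mul_mul_comm, ← Complex.exp_add]
  congr 2
  simp
  ring

theorem map_standardized_add_binomial {Ω : Type*} [MeasurableSpace Ω] {P : Measure Ω}
    [IsProbabilityMeasure P] {p q : unitInterval} {m n : ℕ} {X Y : Ω → ℝ}
    (hX : HasLaw X (Bin(ℝ, m, p)) P) (hY : HasLaw Y (Bin(ℝ, n, q)) P) (hXY : IndepFun X Y P) :
    P.map (fun ω ↦ ((X ω + Y ω) - ((m : ℝ) * (p : ℝ) + (n : ℝ) * (q : ℝ))) /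
        √((m : ℝ) * (p : ℝ) * (1 - (p : ℝ)) + (n : ℝ) * (q : ℝ) * (1 - (q : ℝ)))) =
      standardizedBinomialSum p q (m, n) := by
  have mX := hX.aemeasurable
  have mY := hY.aemeasurable
  rw [standardizedBinomialSum, ← hX.map_eq, ← hY.map_eq,
    ← hXY.map_add_eq_map_conv_map₀ mX mY, AEMeasurable.map_map_of_aemeasurable (by fun_prop)
      (by fun_prop), AEMeasurable.map_map_of_aemeasurable (by fun_prop) (by fun_prop)]
  congr 1
  ext ω
  simp only [binomialSumStdDev, Function.comp_apply, Pi.add_apply, div_eq_inv_mul, sub_eq_add_neg]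

theorem tendsto_binomialSumStdDev {p q : unitInterval}
    (hp0 : 0 < p) (hp1 : p < 1) (hq0 : 0 < q) (hq1 : q < 1) :
    Tendsto (binomialSumStdDev p q) (comap (fun k : ℕ × ℕ ↦ k.1 + k.2) atTop) atTop := by
  have hp0' : (0 : ℝ) < p := hp0
  have hp1' : (p : ℝ) < 1 := hp1
  have hq0' : (0 : ℝ) < q := hq0
  have hq1' : (q : ℝ) < 1 := hq1
  have hvp : 0 < (p : ℝ) * (1 - p) := mul_pos hp0' (sub_pos.2 hp1')
  have hvq : 0 < (q : ℝ) * (1 - q) := mul_pos hq0' (sub_pos.2 hq1')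
  refine Real.tendsto_sqrt_atTop.comp ?_
  have h : Tendsto (fun k : ℕ × ℕ ↦ ((k.1 + k.2 : ℕ) : ℝ) *
      min ((p : ℝ) * (1 - p)) ((q : ℝ) * (1 - q))) (comap (fun k ↦ k.1 + k.2) atTop) atTop :=
    (tendsto_natCast_atTop_atTop.comp tendsto_comap).atTop_mul_const (lt_min hvp hvq)
  refine tendsto_atTop_mono (fun k ↦ ?_) h
  rw [Nat.cast_add, add_mul, mul_assoc, mul_assoc]
  gcongr
  · exact min_le_left _ _
  · exact min_le_right _ _

theorem tendsto_charFun_standardizedBinomialSum {p q : unitInterval}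
    (hp0 : 0 < p) (hp1 : p < 1) (hq0 : 0 < q) (hq1 : q < 1) (t : ℝ) :
    Tendsto (fun k ↦ charFun (standardizedBinomialSum p q k) t)
      (comap (fun k : ℕ × ℕ ↦ k.1 + k.2) atTop) (𝓝 (charFun (gaussianReal 0 1) t)) := by
  have hp0' : (0 : ℝ) < p := hp0
  have hp1' : (p : ℝ) < 1 := hp1
  have hq0' : (0 : ℝ) < q := hq0
  have hq1' : (q : ℝ) < 1 := hq1
  have hvp : 0 < (p : ℝ) * (1 - p) := mul_pos hp0' (sub_pos.2 hp1')
  have hvq : 0 < (q : ℝ) * (1 - q) := mul_pos hq0' (sub_pos.2 hq1')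
  set vp : ℝ := (p : ℝ) * (1 - p) with hvp_def
  set vq : ℝ := (q : ℝ) * (1 - q) with hvq_def
  set s := binomialSumStdDev p q with hs_def
  have hs : Tendsto s (comap (fun k : ℕ × ℕ ↦ k.1 + k.2) atTop) atTop :=
    tendsto_binomialSumStdDev hp0 hp1 hq0 hq1
  have hu : Tendsto (fun k ↦ (s k)⁻¹ * t) (comap (fun k : ℕ × ℕ ↦ k.1 + k.2) atTop) (𝓝 0) := by
    simpa using (tendsto_inv_atTop_zero.comp hs).mul_const t
  have hsq (k : ℕ × ℕ) : s k ^ 2 = k.1 * vp + k.2 * vq := by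
    rw [hs_def, binomialSumStdDev, Real.sq_sqrt, mul_assoc, mul_assoc]
    rw [mul_assoc, mul_assoc]
    positivity
  set c := min vp vq with hc_def
  have hc : 0 < c := lt_min hvp hvq
  rw [Metric.tendsto_nhds]
  intro ε hε
  -- With this constant the final bound is `ε * t² / (t² + 1)`; the `+ 1` keeps it strictly below
  -- `ε` and covers `t = 0`.
  have hδ : 0 < ε * c / (t ^ 2 + 1) := by positivity
  have hP := hu.eventually ((centeredBernoulliCharFun_sub_exp_isLittleO p).def hδ)
  have hQ := hu.eventually ((centeredBernoulliCharFun_sub_exp_isLittleO q).def hδ)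
  filter_upwards [hP, hQ, hs.eventually_gt_atTop 0] with k hPk hQk hsk
  rw [← hvp_def] at hPk
  rw [← hvq_def] at hQk
  set u := (s k)⁻¹ * t with hu_def
  have hu2 : s k ^ 2 * u ^ 2 = t ^ 2 := by
    rw [hu_def]
    field_simp
  have hlim : charFun (gaussianReal 0 1) t =
      Complex.exp (-(vp * u ^ 2 / 2)) ^ k.1 * Complex.exp (-(vq * u ^ 2 / 2)) ^ k.2 := by
    rw [charFun_gaussianReal, ← Complex.exp_nat_mul, ← Complex.exp_nat_mul, ← Complex.exp_add]
    congr 1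
    have h : ((k.1 * vp + k.2 * vq : ℂ)) * u ^ 2 = t ^ 2 := by
      rw [hsq] at hu2
      exact_mod_cast hu2
    simp only [Complex.ofReal_zero, NNReal.coe_one, Complex.ofReal_one]
    linear_combination (1 / 2 : ℂ) * h
  have hck : ((k.1 : ℝ) + k.2) * c ≤ s k ^ 2 := by
    rw [hsq, add_mul]
    gcongr
    · exact min_le_left _ _
    · exact min_le_right _ _
  rw [dist_eq_norm, charFun_standardizedBinomialSum, hlim]
  calc _ ≤ k.1 * ‖centeredBernoulliCharFun p u - Complex.exp (-(vp * u ^ 2 / 2))‖ +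
        k.2 * ‖centeredBernoulliCharFun q u - Complex.exp (-(vq * u ^ 2 / 2))‖ :=
      norm_pow_mul_pow_sub_pow_mul_pow_le (norm_centeredBernoulliCharFun_le_one p u)
        (norm_centeredBernoulliCharFun_le_one q u) (norm_exp_neg_mul_sq_le_one hvp.le u)
        (norm_exp_neg_mul_sq_le_one hvq.le u) _ _
    _ ≤ k.1 * (ε * c / (t ^ 2 + 1) * ‖u ^ 2‖) + k.2 * (ε * c / (t ^ 2 + 1) * ‖u ^ 2‖) := by
      gcongr
    _ = ε / (t ^ 2 + 1) * ((((k.1 : ℝ) + k.2) * c) * u ^ 2) := by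
      rw [Real.norm_of_nonneg (sq_nonneg u)]
      ring
    _ ≤ ε / (t ^ 2 + 1) * (s k ^ 2 * u ^ 2) := by gcongr
    _ = ε * (t ^ 2 / (t ^ 2 + 1)) := by rw [hu2]; ring
    _ < ε * 1 := by
      gcongr
      rw [div_lt_one (by positivity)]
      linarith
    _ = ε := mul_one ε

/-- Working on `ℕ × ℕ` makes the filter countably generated, so sequences suffice for Lévy's
theorem; an arbitrary index filter `l` is then handled by composition. -/
theorem tendsto_standardizedBinomialSum {p q : unitInterval}
    (hp0 : 0 < p) (hp1 : p < 1) (hq0 : 0 < q) (hq1 : q < 1) :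
    Tendsto (β := ProbabilityMeasure ℝ) (fun k ↦ ⟨standardizedBinomialSum p q k, inferInstance⟩)
      (comap (fun k : ℕ × ℕ ↦ k.1 + k.2) atTop) (𝓝 ⟨gaussianReal 0 1, inferInstance⟩) := by
  refine tendsto_of_seq_tendsto fun x hx ↦ ?_
  exact ProbabilityMeasure.tendsto_iff_tendsto_charFun.2 fun t ↦
    (tendsto_charFun_standardizedBinomialSum hp0 hp1 hq0 hq1 t).comp hx


theorem corollary5 {ι : Type*} {l : Filter ι} {p q : unitInterval}
    (hp0 : 0 < p) (hp1 : p < 1) (hq0 : 0 < q) (hq1 : q < 1)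
    (m n : ι → ℕ) (hmn : Tendsto m l atTop ∨ Tendsto n l atTop)
    {Ω : ι → Type*} [∀ i, MeasurableSpace (Ω i)]
    (P : (i : ι) → Measure (Ω i)) [∀ i, IsProbabilityMeasure (P i)]
    (T₁ T₂ : (i : ι) → Ω i → ℝ)
    (hT₁ : ∀ i, HasLaw (T₁ i) (Bin(ℝ, m i, p)) (P i))
    (hT₂ : ∀ i, HasLaw (T₂ i) (Bin(ℝ, n i, q)) (P i))
    (hindep : ∀ i, IndepFun (T₁ i) (T₂ i) (P i))
    {Ω' : Type*} [MeasurableSpace Ω'] (P' : Measure Ω') [IsProbabilityMeasure P']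
    (Z : Ω' → ℝ) (hZ : HasLaw Z (gaussianReal 0 1) P') :
    TendstoInDistribution
      (fun i ω ↦ ((T₁ i ω + T₂ i ω) - ((m i : ℝ) * (p : ℝ) + (n i : ℝ) * (q : ℝ))) /
        √((m i : ℝ) * (p : ℝ) * (1 - (p : ℝ)) + (n i : ℝ) * (q : ℝ) * (1 - (q : ℝ))))
      l Z P P' := by
  have hX (i : ι) : AEMeasurable (fun ω ↦ ((T₁ i ω + T₂ i ω) - ((m i : ℝ) * (p : ℝ) +
      (n i : ℝ) * (q : ℝ))) / √((m i : ℝ) * (p : ℝ) * (1 - (p : ℝ)) +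
        (n i : ℝ) * (q : ℝ) * (1 - (q : ℝ)))) (P i) :=
    (((hT₁ i).aemeasurable.add (hT₂ i).aemeasurable).sub_const _).div_const _
  -- Either alternative forces `m i + n i → ∞`, the other summand being nonnegative.
  have hmn' : Tendsto (fun i ↦ (m i, n i)) l (comap (fun k : ℕ × ℕ ↦ k.1 + k.2) atTop) := by
    rw [tendsto_comap_iff]
    rcases hmn with h | h
    · exact tendsto_atTop_mono (fun i ↦ Nat.le_add_right _ _) h
    · exact tendsto_atTop_mono (fun i ↦ Nat.le_add_left _ _) h
  refine ⟨hX, hZ.aemeasurable, ?_⟩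
  have hZ' : (⟨P'.map Z, Measure.isProbabilityMeasure_map hZ.aemeasurable⟩ :
      ProbabilityMeasure ℝ) = ⟨gaussianReal 0 1, inferInstance⟩ := Subtype.ext hZ.map_eq
  rw [hZ']
  refine ((tendsto_standardizedBinomialSum hp0 hp1 hq0 hq1).comp hmn').congr fun i ↦ ?_
  exact Subtype.ext (map_standardized_add_binomial (hT₁ i) (hT₂ i) (hindep i)).symm
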